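/- Let $\mu$ be a finite Borel measure on $\mathbb{C}$ whose support is compact and infinite, and let $\varphi_n=\varphi_n(\cdot\,;\mu)$ be its orthonormal polynomials, obtained by Gram–Schmidt orthogonalization of $1,z,z^2,\dots$ in $L^2(\mu)$ and normalized so that the leading coefficient of $\varphi_n$ is positive. Let $K\subset\mathbb{C}$ be a compact set bounded by a Jordan curve, let $\phi_K$ denote the conformal bijection of $\overline{\mathbb{C}}\setminus K$ onto $\overline{\mathbb{C}}\setminus\overline{\mathbb{D}}$ with $\phi_K(\infty)=\infty$ and $\phi_K'(\infty):=\lim_{z\to\infty}\phi_K(z)/z>0$, and let $\psi_K$ be its inverse. Suppose that for some $R$ $$\lim_{n\to\infty}\frac{\varphi_n(z)}{\varphi_{n+1}(z)}=\frac{1}{\phi_K(z)}\qquad\text{for all } |z|>R .$$ Then for every integer $j\ge 0$ $$\lim_{n\to\infty}\int_{\mathbb{C}}z^j|\varphi_n(z)|^2\,d\mu(z)=\int_0^{2\pi}\psi_K(e^{i\theta})^j\,\frac{d\theta}{2\pi}.$$ Here $\psi_K(e^{i\theta})$ is the boundary value $\lim_{r\downarrow 1}\psi_K(re^{i\theta})$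 (the value of the continuous extension of $\psi_K$ to the unit circle); part of the assertion is that this limit exists for almost every $\theta$ and that the integrand on the right is integrable. -/

import Mathlib

open Filter Topology MeasureTheory Polynomial

noncomputable section

/-- The sesquilinear pairing `∫ p(z) \overline{q(z)} dμ(z)` of two polynomials. -/
def polyInner (μ : Measure ℂ) (p q : ℂ[X]) : ℂ :=
  ∫ z, p.eval z * (starRingEnd ℂ) (q.eval z) ∂μ

/-- The monic orthogonal polynomials `Φ_n(·; μ)`: Gram-Schmidt orthogonalization (without
normalization) of `1, z, z², …` in `L²(μ)`. -/
def monicOrthoPoly (μ : Measure ℂ) (n : ℕ) : ℂ[X] :=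
  X ^ n - ∑ k : Fin n,
    C (polyInner μ (X ^ n) (monicOrthoPoly μ k) /
      polyInner μ (monicOrthoPoly μ k) (monicOrthoPoly μ k)) * monicOrthoPoly μ k
termination_by n
decreasing_by all_goals exact k.2

/-- The orthonormal polynomials `φ_n(·; μ) = Φ_n / ‖Φ_n‖_{L²(μ)}`. -/
def orthonormalPoly (μ : Measure ℂ) (n : ℕ) : ℂ[X] :=
  C (((Real.sqrt (∫ z, ‖(monicOrthoPoly μ n).eval z‖ ^ 2 ∂μ))⁻¹ : ℝ) : ℂ) * monicOrthoPoly μ n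

/-- A Jordan curve in the plane: an injective continuous image of the unit circle. -/
def IsJordanCurve (J : Set ℂ) : Prop :=
  ∃ γ : Circle → ℂ, Continuous γ ∧ Function.Injective γ ∧ Set.range γ = J

/-- `φ` is the conformal bijection from the complement of `K` onto the complement of the closed
unit disk, both in the extended plane, with `φ(∞) = ∞` and `φ'(∞) > 0`. The point at infinity is
expressed through the filter `Bornology.cobounded ℂ` of its punctured neighbourhoods, and `φ'(∞)`
is the leading coefficient `lim φ(z) / z`. The values of `φ` on `K` are irrelevant. -/
structure IsExteriorConformalMap (K : Set ℂ) (φ : ℂ → ℂ) : Prop where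
  differentiableOn : DifferentiableOn ℂ φ Kᶜ
  bijOn : Set.BijOn φ Kᶜ {w : ℂ | 1 < ‖w‖}
  map_infty : Tendsto φ (Bornology.cobounded ℂ) (Bornology.cobounded ℂ)
  deriv_infty_pos : ∃ c : ℝ, 0 < c ∧
    Tendsto (fun z : ℂ => φ z / z) (Bornology.cobounded ℂ) (𝓝 (c : ℂ))

/-- The boundary value at a point `ζ` of the unit circle of a function `ψ` given on `|w| > 1`: the
radial limit from outside. If `ψ` extends continuously to `|w| ≥ 1`, this is the value at `ζ` of
the extension, see `exteriorBoundaryValue_eq`. -/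
def exteriorBoundaryValue (ψ : ℂ → ℂ) (ζ : ℂ) : ℂ :=
  limUnder (𝓝[>] (1 : ℝ)) (fun r : ℝ => ψ ((r : ℂ) * ζ))

/-- The boundary values are those of the continuous extension, where there is one. -/
theorem exteriorBoundaryValue_eq {ψ Ψ : ℂ → ℂ} (hΨ : ContinuousOn Ψ {w : ℂ | 1 ≤ ‖w‖})
    (hext : Set.EqOn Ψ ψ {w : ℂ | 1 < ‖w‖}) {ζ : ℂ} (hζ : ‖ζ‖ = 1) :
    exteriorBoundaryValue ψ ζ = Ψ ζ := by
  apply Tendsto.limUnder_eq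
  have h1 : Tendsto (fun r : ℝ => (r : ℂ) * ζ) (𝓝[>] (1 : ℝ)) (𝓝[{w : ℂ | 1 ≤ ‖w‖}] ζ) := by
    refine tendsto_nhdsWithin_iff.2 ⟨?_, ?_⟩
    · have : Continuous (fun r : ℝ => (r : ℂ) * ζ) := by fun_prop
      simpa using (this.tendsto 1).mono_left nhdsWithin_le_nhds
    · filter_upwards [self_mem_nhdsWithin] with r hr
      have hr' : (1 : ℝ) < r := hr
      change 1 ≤ ‖_‖
      simp only [norm_mul, Complex.norm_real, hζ, mul_one, Real.norm_eq_abs]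
      exact hr'.le.trans (le_abs_self r)
  refine ((hΨ ζ (by simp [hζ])).tendsto.comp h1).congr' ?_
  filter_upwards [self_mem_nhdsWithin] with r hr
  have hr' : (1 : ℝ) < r := hr
  apply hext
  change 1 < ‖_‖
  simp only [norm_mul, Complex.norm_real, hζ, mul_one, Real.norm_eq_abs]
  exact hr'.trans_le (le_abs_self r)

end

/-! Expand `z ^ j φ_n` in the orthonormal basis. By degree only `φ_{n+j-m}` with `m ≥ 0` occur, and
the coefficient at `m = j` is exactly `∫ z ^ j |φ_n|² dμ`. Divide by `φ_{n+j}` and let `n → ∞`: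
ratio asymptotics turn `φ_{n+j-m} / φ_{n+j}` into `φ(z) ^ (-m)`. If the coefficients tend to `c m`,
the substitution `z = ψ w` gives `ψ(w) ^ j w ^ (-j) = ∑ c m w ^ (-m)`, so `c j` is the constant
Laurent coefficient of `ψ ^ j`, that is, its mean over a circle. Since the `c m` are determined by
`ψ`, it suffices to treat limits along ultrafilters, which exist because all coefficients are
bounded by `R ^ j`.

The interchange of limit and sum needs a geometric majorant. It comes from
`norm_orthonormalPoly_ratio_le`: far from the support, `|φ_n / φ_{n+1}| ≤ R / (|z| - R) < 1`,
uniformly in `n`.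

It remains to move the circle to the unit circle. A univalent map with bounded image has square
integrable derivative (its integral is an area), so almost every radius has image of finite length
and a limit exists; dominated convergence does the rest. -/

open Filter Topology MeasureTheory Polynomial

noncomputable section

/-! ### Orthogonal polynomials: orthogonality, zeros and ratio bounds -/

section OrthogonalPolynomials

variable {μ : Measure ℂ}

theorem integrable_of_continuous_of_isCompact_support [IsFiniteMeasure μ]
    (hc : IsCompact μ.support) {E : Type*} [NormedAddCommGroup E]
    [SecondCountableTopologyEither ℂ E] {f : ℂ → E}
    (hf : Continuous f) : Integrable f μ := by
  have h : μ.restrict μ.support = μ :=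
    Measure.restrict_eq_self_of_ae_mem Measure.support_mem_ae
  rw [← h]
  exact hf.continuousOn.integrableOn_compact hc

/-- The squared `L²` norm of a polynomial. -/
def polyNormSq (μ : Measure ℂ) (p : ℂ[X]) : ℝ := ∫ z, ‖p.eval z‖ ^ 2 ∂μ

theorem polyNormSq_nonneg (p : ℂ[X]) : 0 ≤ polyNormSq μ p :=
  integral_nonneg fun _ => by positivity

theorem polyInner_self (p : ℂ[X]) : polyInner μ p p = (polyNormSq μ p : ℂ) := by
  unfold polyInner polyNormSq
  rw [← integral_complex_ofReal]
  congr 1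
  ext z
  rw [Complex.mul_conj, Complex.normSq_eq_norm_sq]

/-- Vanishing norm would force the support into the finite zero set of `p`. -/
theorem polyNormSq_pos [IsFiniteMeasure μ] (hc : IsCompact μ.support)
    (hi : μ.support.Infinite) {p : ℂ[X]} (hp : p ≠ 0) : 0 < polyNormSq μ p := by
  refine lt_of_le_of_ne (polyNormSq_nonneg p) fun h => hi ?_
  have h0 : (fun z => ‖p.eval z‖ ^ 2) =ᵐ[μ] 0 := by
    rw [← integral_eq_zero_iff_of_nonneg (fun _ => by positivity)
      (integrable_of_continuous_of_isCompact_support hc (by fun_prop))]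
    exact h.symm
  refine (p.rootSet_finite ℂ).subset
    (Measure.support_subset_of_isClosed (p.rootSet_finite ℂ).isClosed ?_)
  filter_upwards [h0] with z hz
  rw [mem_rootSet]
  exact ⟨hp, by simpa using hz⟩

theorem polyInner_add_left [IsFiniteMeasure μ] (hc : IsCompact μ.support) (p q r : ℂ[X]) :
    polyInner μ (p + q) r = polyInner μ p r + polyInner μ q r := by
  unfold polyInner
  rw [← integral_add (integrable_of_continuous_of_isCompact_support hc (by fun_prop))
    (integrable_of_continuous_of_isCompact_support hc (by fun_prop))]
  simp only [eval_add, add_mul]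

theorem polyInner_C_mul_left (c : ℂ) (p r : ℂ[X]) :
    polyInner μ (C c * p) r = c * polyInner μ p r := by
  unfold polyInner
  rw [← integral_const_mul]
  simp only [eval_mul, eval_C, mul_assoc]

theorem polyInner_zero_left (r : ℂ[X]) : polyInner μ 0 r = 0 := by
  simp [polyInner]

theorem polyInner_neg_left (p r : ℂ[X]) : polyInner μ (-p) r = -polyInner μ p r := by
  simp [polyInner, integral_neg]

theorem polyInner_sub_left [IsFiniteMeasure μ] (hc : IsCompact μ.support) (p q r : ℂ[X]) :
    polyInner μ (p - q) r = polyInner μ p r - polyInner μ q r := by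
  rw [sub_eq_add_neg, polyInner_add_left hc, polyInner_neg_left, sub_eq_add_neg]

theorem polyInner_sum_left [IsFiniteMeasure μ] (hc : IsCompact μ.support) {ι : Type*}
    (s : Finset ι) (f : ι → ℂ[X]) (r : ℂ[X]) :
    polyInner μ (∑ i ∈ s, f i) r = ∑ i ∈ s, polyInner μ (f i) r := by
  classical
  induction s using Finset.induction_on with
  | empty => simp [polyInner_zero_left]
  | insert a s ha ih => rw [Finset.sum_insert ha, Finset.sum_insert ha, polyInner_add_left hc, ih]

theorem polyInner_conj_symm (p q : ℂ[X]) :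
    (starRingEnd ℂ) (polyInner μ p q) = polyInner μ q p := by
  unfold polyInner
  rw [← integral_conj]
  congr 1
  ext z
  simp [mul_comm]

theorem polyInner_eq_zero_symm {p q : ℂ[X]} (h : polyInner μ p q = 0) : polyInner μ q p = 0 := by
  rw [← polyInner_conj_symm, h, map_zero]

/-- A weighted arithmetic-geometric mean bound for a pairing with a multiplier bounded by `B` on
the support. -/
theorem norm_integral_mul_pairing_le [IsFiniteMeasure μ] (hc : IsCompact μ.support)
    {B : ℝ} {m : ℂ[X]} (hB : 0 ≤ B) (hm : ∀ z ∈ μ.support, ‖m.eval z‖ ≤ B) (p q : ℂ[X])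
    {d : ℝ} (hd : 0 < d) :
    ‖polyInner μ (m * p) q‖ ≤ B * (d * polyNormSq μ p + d⁻¹ * polyNormSq μ q) / 2 := by
  unfold polyInner polyNormSq
  have h1 : Integrable (fun z => ‖p.eval z‖ ^ 2) μ :=
    integrable_of_continuous_of_isCompact_support hc (by fun_prop)
  have h2 : Integrable (fun z => ‖q.eval z‖ ^ 2) μ :=
    integrable_of_continuous_of_isCompact_support hc (by fun_prop)
  rw [← integral_const_mul, ← integral_const_mul,
    ← integral_add (h1.const_mul d) (h2.const_mul _), ← integral_const_mul, ← integral_div]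
  refine norm_integral_le_of_norm_le
    ((((h1.const_mul d).add (h2.const_mul _)).const_mul B).div_const 2) ?_
  filter_upwards [Measure.support_mem_ae (μ := μ)] with z hz
  simp only [eval_mul, norm_mul, RCLike.norm_conj]
  have h3 : ‖p.eval z‖ * ‖q.eval z‖ ≤ (d * ‖p.eval z‖ ^ 2 + d⁻¹ * ‖q.eval z‖ ^ 2) / 2 := by
    have h4 : 0 ≤ d⁻¹ * (d * ‖p.eval z‖ - ‖q.eval z‖) ^ 2 := by positivity
    have h5 : d⁻¹ * (d * ‖p.eval z‖ - ‖q.eval z‖) ^ 2 =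
        d * ‖p.eval z‖ ^ 2 + d⁻¹ * ‖q.eval z‖ ^ 2 - 2 * (‖p.eval z‖ * ‖q.eval z‖) := by
      field_simp
      ring
    linarith
  calc ‖m.eval z‖ * ‖p.eval z‖ * ‖q.eval z‖ = ‖m.eval z‖ * (‖p.eval z‖ * ‖q.eval z‖) := by ring
    _ ≤ B * ((d * ‖p.eval z‖ ^ 2 + d⁻¹ * ‖q.eval z‖ ^ 2) / 2) := by
      gcongr
      exact hm z hz
    _ = _ := by ring

theorem degree_const_mul_le (c : ℂ) (p : ℂ[X]) : (C c * p).degree ≤ p.degree := by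
  rw [← smul_eq_C_mul]
  exact degree_smul_le c p

theorem monicOrthoPoly_natDegree_and_monic (n : ℕ) :
    (monicOrthoPoly μ n).natDegree = n ∧ (monicOrthoPoly μ n).Monic := by
  induction n using Nat.strong_induction_on with
  | _ n ih =>
    have hlt : (∑ k : Fin n,
        C (polyInner μ (X ^ n) (monicOrthoPoly μ k) /
          polyInner μ (monicOrthoPoly μ k) (monicOrthoPoly μ k)) *
            monicOrthoPoly μ k).degree < (n : WithBot ℕ) := by
      refine (degree_sum_le _ _).trans_lt ((Finset.sup_lt_iff (WithBot.bot_lt_coe n)).2 ?_)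
      intro k _
      refine (degree_const_mul_le _ _).trans_lt (degree_le_natDegree.trans_lt ?_)
      rw [(ih k k.2).1]
      exact Nat.cast_lt.2 k.2
    have hX : (X ^ n : ℂ[X]).degree = n := degree_X_pow n
    rw [monicOrthoPoly]
    have hm : (X ^ n - ∑ k : Fin n,
        C (polyInner μ (X ^ n) (monicOrthoPoly μ k) /
          polyInner μ (monicOrthoPoly μ k) (monicOrthoPoly μ k)) *
            monicOrthoPoly μ k).Monic := by
      simpa [sub_eq_add_neg] using monic_X_pow_add (p := -_) (by rwa [degree_neg])
    refine ⟨natDegree_eq_of_degree_eq_some ?_, hm⟩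
    rw [degree_sub_eq_left_of_degree_lt (by rwa [hX]), hX]

theorem monicOrthoPoly_ne_zero (n : ℕ) : monicOrthoPoly μ n ≠ 0 :=
  (monicOrthoPoly_natDegree_and_monic n).2.ne_zero

/-- The projection onto `Φ_k` is subtracted off, and the other summands are orthogonal to `Φ_k` by
induction on the larger index. -/
theorem polyInner_monicOrthoPoly_of_lt [IsFiniteMeasure μ] (hc : IsCompact μ.support)
    (hi : μ.support.Infinite) {n k : ℕ} (hk : k < n) :
    polyInner μ (monicOrthoPoly μ n) (monicOrthoPoly μ k) = 0 := by
  induction n using Nat.strong_induction_on generalizing k with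
  | _ n ih =>
    rw [monicOrthoPoly, polyInner_sub_left hc, polyInner_sum_left hc,
      Finset.sum_eq_single (⟨k, hk⟩ : Fin n)]
    · have hne : polyInner μ (monicOrthoPoly μ k) (monicOrthoPoly μ k) ≠ 0 := by
        rw [polyInner_self]
        exact_mod_cast (polyNormSq_pos hc hi (monicOrthoPoly_ne_zero k)).ne'
      rw [polyInner_C_mul_left, div_mul_cancel₀ _ hne, sub_self]
    · intro i _ hik
      have hik' : (i : ℕ) ≠ k := fun h => hik (Fin.ext h)
      rw [polyInner_C_mul_left]
      rcases lt_or_gt_of_ne hik' with h | h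
      · rw [polyInner_eq_zero_symm (ih k hk h), mul_zero]
      · rw [ih i i.2 h, mul_zero]
    · simp

theorem orthonormalPoly_eq (n : ℕ) : orthonormalPoly μ n =
    C (((Real.sqrt (polyNormSq μ (monicOrthoPoly μ n)))⁻¹ : ℝ) : ℂ) * monicOrthoPoly μ n := rfl

theorem normalization_ne_zero [IsFiniteMeasure μ] (hc : IsCompact μ.support)
    (hi : μ.support.Infinite) (n : ℕ) :
    (((Real.sqrt (polyNormSq μ (monicOrthoPoly μ n)))⁻¹ : ℝ) : ℂ) ≠ 0 := by
  have := Real.sqrt_pos.2 (polyNormSq_pos hc hi (monicOrthoPoly_ne_zero (μ := μ) n))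
  exact_mod_cast (inv_pos.2 this).ne'

theorem orthonormalPoly_degree [IsFiniteMeasure μ] (hc : IsCompact μ.support)
    (hi : μ.support.Infinite) (n : ℕ) : (orthonormalPoly μ n).degree = n := by
  rw [orthonormalPoly_eq, degree_C_mul (normalization_ne_zero hc hi n),
    degree_eq_natDegree (monicOrthoPoly_ne_zero n), (monicOrthoPoly_natDegree_and_monic n).1]

theorem polyInner_orthonormalPoly_of_ne [IsFiniteMeasure μ] (hc : IsCompact μ.support)
    (hi : μ.support.Infinite) {n k : ℕ} (hk : n ≠ k) :
    polyInner μ (orthonormalPoly μ n) (orthonormalPoly μ k) = 0 := by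
  have key : ∀ {n k : ℕ}, k < n →
      polyInner μ (orthonormalPoly μ n) (orthonormalPoly μ k) = 0 := by
    intro n k h
    rw [orthonormalPoly_eq n, polyInner_C_mul_left]
    refine mul_eq_zero_of_right _ (polyInner_eq_zero_symm ?_)
    rw [orthonormalPoly_eq k, polyInner_C_mul_left,
      polyInner_eq_zero_symm (polyInner_monicOrthoPoly_of_lt hc hi h), mul_zero]
  rcases lt_or_gt_of_ne hk with h | h
  · exact polyInner_eq_zero_symm (key h)
  · exact key h

theorem polyNormSq_orthonormalPoly [IsFiniteMeasure μ] (hc : IsCompact μ.support)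
    (hi : μ.support.Infinite) (n : ℕ) : polyNormSq μ (orthonormalPoly μ n) = 1 := by
  have hpos := polyNormSq_pos hc hi (monicOrthoPoly_ne_zero (μ := μ) n)
  have h : ∀ (c : ℂ) (p : ℂ[X]), polyNormSq μ (C c * p) = ‖c‖ ^ 2 * polyNormSq μ p := by
    intro c p
    unfold polyNormSq
    rw [← integral_const_mul]
    simp [mul_pow]
  rw [orthonormalPoly_eq, h, Complex.norm_real, Real.norm_eq_abs, sq_abs, inv_pow,
    Real.sq_sqrt hpos.le, inv_mul_cancel₀ hpos.ne']

theorem polyInner_orthonormalPoly_self [IsFiniteMeasure μ] (hc : IsCompact μ.support)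
    (hi : μ.support.Infinite) (n : ℕ) :
    polyInner μ (orthonormalPoly μ n) (orthonormalPoly μ n) = 1 := by
  rw [polyInner_self, polyNormSq_orthonormalPoly hc hi, Complex.ofReal_one]

/-- Expansion of a polynomial in the orthonormal polynomials. -/
theorem eq_sum_polyInner_orthonormalPoly [IsFiniteMeasure μ] (hc : IsCompact μ.support)
    (hi : μ.support.Infinite) (N : ℕ) (p : ℂ[X]) (hp : p.degree < N) :
    p = ∑ k ∈ Finset.range N,
      C (polyInner μ p (orthonormalPoly μ k)) * orthonormalPoly μ k := by
  suffices h : ∃ a : ℕ → ℂ, p = ∑ k ∈ Finset.range N, C (a k) * orthonormalPoly μ k by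
    obtain ⟨a, ha⟩ := h
    have hcoef : ∀ k ∈ Finset.range N, polyInner μ p (orthonormalPoly μ k) = a k := by
      intro k hk
      rw [ha, polyInner_sum_left hc, Finset.sum_eq_single_of_mem k hk, polyInner_C_mul_left,
        polyInner_orthonormalPoly_self hc hi, mul_one]
      intro i _ hik
      rw [polyInner_C_mul_left, polyInner_orthonormalPoly_of_ne hc hi hik, mul_zero]
    conv_lhs => rw [ha]
    exact Finset.sum_congr rfl fun k hk => by rw [hcoef k hk]
  induction N generalizing p with
  | zero =>
    refine ⟨0, ?_⟩
    have : p = 0 := by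
      rw [← degree_eq_bot, ← Nat.WithBot.lt_zero_iff]
      exact_mod_cast hp
    simpa using this
  | succ N ih =>
    have hlc : (orthonormalPoly μ N).coeff N ≠ 0 :=
      coeff_ne_zero_of_eq_degree (orthonormalPoly_degree hc hi N)
    set b : ℂ := p.coeff N / (orthonormalPoly μ N).coeff N with hb
    obtain ⟨a, ha⟩ := ih (p - C b * orthonormalPoly μ N) (by
      rw [degree_lt_iff_coeff_zero]
      intro m hm
      rcases hm.eq_or_lt with rfl | hm
      · rw [coeff_sub, coeff_C_mul, hb, div_mul_cancel₀ _ hlc, sub_self]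
      · rw [coeff_sub, coeff_C_mul, coeff_eq_zero_of_degree_lt,
          coeff_eq_zero_of_degree_lt (p := orthonormalPoly μ N), mul_zero, sub_zero]
        · rw [orthonormalPoly_degree hc hi]
          exact_mod_cast hm
        · exact hp.trans_le (by exact_mod_cast hm))
    refine ⟨fun k => if k = N then b else a k, ?_⟩
    simp only [Finset.sum_range_succ, if_true]
    rw [← sub_eq_iff_eq_add, ha]
    refine Finset.sum_congr rfl fun k hk => ?_
    rw [if_neg (Finset.mem_range.1 hk).ne]

theorem polyInner_orthonormalPoly_right_of_degree_lt [IsFiniteMeasure μ]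
    (hc : IsCompact μ.support) (hi : μ.support.Infinite) {N : ℕ} {p : ℂ[X]} (hp : p.degree < N) :
    polyInner μ p (orthonormalPoly μ N) = 0 := by
  rw [eq_sum_polyInner_orthonormalPoly hc hi N p hp, polyInner_sum_left hc]
  refine Finset.sum_eq_zero fun k hk => ?_
  rw [polyInner_C_mul_left, polyInner_orthonormalPoly_of_ne hc hi (Finset.mem_range.1 hk).ne,
    mul_zero]

/-- Multiplication by `z₀ - z` is bounded below outside a disk containing the support. -/
theorem mul_polyNormSq_le_norm_polyInner [IsFiniteMeasure μ] (hc : IsCompact μ.support)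
    {R : ℝ} (hR : ∀ z ∈ μ.support, ‖z‖ ≤ R) {z₀ : ℂ} (v : ℂ[X]) :
    (‖z₀‖ - R) * polyNormSq μ v ≤ ‖polyInner μ ((C z₀ - X) * v) v‖ := by
  rcases eq_or_ne z₀ 0 with rfl | hz
  · rcases eq_or_ne μ 0 with rfl | hμ
    · simp [polyNormSq]
    · obtain ⟨z, hz⟩ := Measure.nonempty_support hμ
      have h1 : 0 ≤ R := (norm_nonneg z).trans (hR z hz)
      have h2 := mul_nonneg h1 (polyNormSq_nonneg (μ := μ) v)
      have h3 := norm_nonneg (polyInner μ ((C 0 - X) * v) v)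
      rw [norm_zero]
      linarith
  have h1 : polyInner μ ((C z₀ - X) * v) v = z₀ * polyInner μ v v - polyInner μ (X * v) v := by
    rw [sub_mul, polyInner_sub_left hc, polyInner_C_mul_left]
  have h2 : ‖polyInner μ (X * v) v‖ ≤ R * polyNormSq μ v := by
    -- A point of the support is what gives `0 ≤ R`; for `μ = 0` both sides vanish.
    rcases eq_or_ne μ 0 with rfl | hμ
    · simp [polyInner, polyNormSq]
    obtain ⟨z, hz⟩ := Measure.nonempty_support hμ
    have h := norm_integral_mul_pairing_le hc ((norm_nonneg z).trans (hR z hz)) (m := X)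
      (by simpa using hR) v v one_pos
    simpa using h.trans_eq (by ring)
  have h3 : ‖z₀ * polyInner μ v v‖ = ‖z₀‖ * polyNormSq μ v := by
    rw [norm_mul, polyInner_self, Complex.norm_real, Real.norm_of_nonneg (polyNormSq_nonneg v)]
  rw [h1]
  have h4 := norm_sub_norm_le (z₀ * polyInner μ v v) (polyInner μ (X * v) v)
  rw [h3] at h4
  linarith

theorem exists_eq_sub_mul {p : ℂ[X]} {z₀ : ℂ} (h : p.eval z₀ = 0) {n : ℕ}
    (hp : p.degree < (n + 1 : ℕ)) :
    ∃ v : ℂ[X], p = (C z₀ - X) * v ∧ v.degree < n := by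
  obtain ⟨q, hq⟩ := dvd_iff_isRoot.2 h
  refine ⟨-q, by rw [hq]; ring, ?_⟩
  rw [degree_neg]
  rcases eq_or_ne q 0 with rfl | hq0
  · rw [degree_zero]
    exact WithBot.bot_lt_coe n
  rw [hq, degree_mul, degree_X_sub_C, degree_eq_natDegree hq0] at hp
  rw [degree_eq_natDegree hq0]
  norm_cast at hp ⊢
  omega

/-- The zeros of orthogonal polynomials lie in every disk about `0` containing the support. -/
theorem eval_orthonormalPoly_ne_zero [IsFiniteMeasure μ] (hc : IsCompact μ.support)
    (hi : μ.support.Infinite) {R : ℝ} (hR : ∀ z ∈ μ.support, ‖z‖ ≤ R) {z₀ : ℂ} (hz : R < ‖z₀‖)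
    (n : ℕ) : (orthonormalPoly μ n).eval z₀ ≠ 0 := by
  intro h
  have hdeg := orthonormalPoly_degree hc hi n
  obtain ⟨v, hv, hvd⟩ := exists_eq_sub_mul h (n := n)
    (by rw [hdeg]; exact_mod_cast Nat.lt_succ_self n)
  have hv0 : v ≠ 0 := by
    rintro rfl
    rw [hv, mul_zero, degree_zero] at hdeg
    exact WithBot.bot_ne_coe hdeg
  -- Here `φ_n = (z₀ - X) v` is orthogonal to `v`, which has lower degree, so the lower bound forces
  -- `v = 0`.
  have h1 := mul_polyNormSq_le_norm_polyInner hc hR (z₀ := z₀) v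
  rw [← hv, polyInner_eq_zero_symm (polyInner_orthonormalPoly_right_of_degree_lt hc hi hvd),
    norm_zero] at h1
  have h2 := mul_pos (sub_pos.2 hz) (polyNormSq_pos hc hi hv0)
  linarith

/-- With `ρ` the ratio, `φ_n - ρ φ_{n+1}` vanishes at `z₀`, hence equals `(z₀ - X) v` with `v`
orthogonal to `φ_{n+1}`. Pairing with `v` removes `ρ` and gives `‖v‖ ≤ 1 / d`; pairing with
`φ_{n+1}` isolates `ρ = ⟨X v, φ_{n+1}⟩`, which is at most `R ‖v‖`. -/
theorem norm_orthonormalPoly_ratio_le [IsFiniteMeasure μ] (hc : IsCompact μ.support)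
    (hi : μ.support.Infinite) {R : ℝ} (hR0 : 0 ≤ R) (hR : ∀ z ∈ μ.support, ‖z‖ ≤ R) {z₀ : ℂ}
    (hz : R < ‖z₀‖) (n : ℕ) :
    ‖(orthonormalPoly μ n).eval z₀ / (orthonormalPoly μ (n + 1)).eval z₀‖ ≤ R / (‖z₀‖ - R) := by
  set ρ := (orthonormalPoly μ n).eval z₀ / (orthonormalPoly μ (n + 1)).eval z₀ with hρ
  set d := ‖z₀‖ - R with hd
  have hd0 : 0 < d := sub_pos.2 hz
  have hne := eval_orthonormalPoly_ne_zero hc hi hR hz (n + 1)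
  have hdn := orthonormalPoly_degree hc hi n
  have hdn1 := orthonormalPoly_degree hc hi (n + 1)
  obtain ⟨v, hv, hvd⟩ := exists_eq_sub_mul (z₀ := z₀) (n := n + 1)
    (p := orthonormalPoly μ n - C ρ * orthonormalPoly μ (n + 1))
    (by rw [eval_sub, eval_mul, eval_C, hρ, div_mul_cancel₀ _ hne, sub_self])
    (by
      refine (degree_sub_le _ _).trans_lt (max_lt ?_ ((degree_const_mul_le _ _).trans_lt ?_))
      · rw [hdn]; exact_mod_cast (by omega : n < n + 1 + 1)
      · rw [hdn1]; exact_mod_cast Nat.lt_succ_self (n + 1))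
  have hperp := polyInner_orthonormalPoly_right_of_degree_lt hc hi hvd
  have h1 : polyInner μ ((C z₀ - X) * v) v = polyInner μ (orthonormalPoly μ n) v := by
    rw [← hv, polyInner_sub_left hc, polyInner_C_mul_left, polyInner_eq_zero_symm hperp, mul_zero,
      sub_zero]
  have h2 := mul_polyNormSq_le_norm_polyInner hc hR (z₀ := z₀) v
  -- The weight `d⁻¹` leaves `d ‖v‖² / 2` on the right, to be absorbed into the left side of `h2`.
  have h3 := norm_integral_mul_pairing_le hc zero_le_one (m := 1) (by simp)
    (orthonormalPoly μ n) v (inv_pos.2 hd0)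
  rw [one_mul, inv_inv, polyNormSq_orthonormalPoly hc hi] at h3
  rw [h1] at h2
  have h4 : d * polyNormSq μ v ≤ d⁻¹ := by linarith
  have h5 : ρ = polyInner μ (X * v) (orthonormalPoly μ (n + 1)) := by
    have e1 : polyInner μ ((C z₀ - X) * v) (orthonormalPoly μ (n + 1)) = -ρ := by
      rw [← hv, polyInner_sub_left hc, polyInner_C_mul_left, polyInner_orthonormalPoly_self hc hi,
        polyInner_orthonormalPoly_of_ne hc hi (Nat.succ_ne_self n).symm, mul_one, zero_sub]
    rw [sub_mul, polyInner_sub_left hc, polyInner_C_mul_left, hperp, mul_zero, zero_sub] at e1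
    exact (neg_injective e1).symm
  have h6 := norm_integral_mul_pairing_le hc hR0 (m := X) (by simpa using hR) v
    (orthonormalPoly μ (n + 1)) hd0
  rw [← h5, polyNormSq_orthonormalPoly hc hi] at h6
  refine h6.trans ?_
  have h7 : R * (d * polyNormSq μ v + d⁻¹ * 1) ≤ R * (d⁻¹ + d⁻¹ * 1) := by gcongr
  calc _ ≤ R * (d⁻¹ + d⁻¹ * 1) / 2 := by linarith
    _ = R / d := by ring

end OrthogonalPolynomials

end

noncomputable section

/-! ### Univalent functions on the exterior disk and their boundary values -/

section ExteriorFunctions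

/-- The inverse of an injective holomorphic function is holomorphic. -/
theorem analyticAt_of_invOn {U V : Set ℂ} (hU : IsOpen U) {φ ψ : ℂ → ℂ}
    (hd : DifferentiableOn ℂ φ U) (hb : Set.BijOn φ U V) (hinv : Set.InvOn ψ φ U V) {w₀ : ℂ}
    (hw₀ : w₀ ∈ V) : AnalyticAt ℂ ψ w₀ := by
  have hmaps : Set.MapsTo ψ V U := (hb.symm hinv.symm).mapsTo
  have hnonconst : ∀ z ∈ U, ¬ ∀ᶠ y in 𝓝 z, φ y = φ z := by
    intro z hz h
    have h1 : ∀ᶠ y in 𝓝 z, y = z := by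
      filter_upwards [h, hU.mem_nhds hz] with y hy hyU
      exact hb.injOn hyU hz hy
    have h2 : ∀ᶠ y in 𝓝[≠] z, False := by
      filter_upwards [h1.filter_mono nhdsWithin_le_nhds, self_mem_nhdsWithin] with y hy hne
      exact hne hy
    exact (NormedField.nhdsNE_neBot z).ne (by simpa using h2)
  -- The open mapping theorem; it makes `V` open and `ψ` continuous.
  have hopen : ∀ z ∈ U, 𝓝 (φ z) ≤ map φ (𝓝 z) := fun z hz =>
    ((hd.analyticAt (hU.mem_nhds hz)).eventually_constant_or_nhds_le_map_nhds).resolve_left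
      (hnonconst z hz)
  have hV : ∀ w ∈ V, V ∈ 𝓝 w := by
    intro w hw
    have h := hopen _ (hmaps hw)
    rw [hinv.2 hw] at h
    exact h (mem_map.2 (mem_of_superset (hU.mem_nhds (hmaps hw)) fun z hz => hb.mapsTo hz))
  have hcont : ∀ w ∈ V, ContinuousAt ψ w := by
    intro w hw
    have h := hopen _ (hmaps hw)
    rw [hinv.2 hw] at h
    refine Tendsto.mono_left (tendsto_map'_iff.2 ?_) h
    refine (tendsto_id (α := ℂ)).congr' ?_
    filter_upwards [hU.mem_nhds (hmaps hw)] with z hz using (hinv.1 hz).symm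
  set z₀ := ψ w₀ with hz₀
  have hz₀U : z₀ ∈ U := hmaps hw₀
  -- Zeros of the derivative are isolated, which is enough: `ψ` is differentiable on a punctured
  -- neighbourhood and continuous at `w₀`, so the singularity is removable.
  have hderiv : ∀ᶠ z in 𝓝[≠] z₀, deriv φ z ≠ 0 := by
    refine ((hd.analyticAt (hU.mem_nhds hz₀U)).deriv.eventually_eq_zero_or_eventually_ne_zero
      ).resolve_left fun h => hnonconst z₀ hz₀U ?_
    obtain ⟨ε, hε, hball⟩ := Metric.eventually_nhds_iff_ball.1 (h.and (hU.mem_nhds hz₀U))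
    filter_upwards [Metric.ball_mem_nhds z₀ hε] with y hy
    exact (Metric.isOpen_ball.is_const_of_deriv_eq_zero
      (convex_ball z₀ ε).isPreconnected (hd.mono fun z hz => (hball z hz).2)
      (fun z hz => (hball z hz).1) hy (Metric.mem_ball_self hε))
  refine Complex.analyticAt_of_differentiable_on_punctured_nhds_of_continuousAt ?_ (hcont w₀ hw₀)
  have hψ : Tendsto ψ (𝓝[≠] w₀) (𝓝[≠] z₀) := by
    refine tendsto_nhdsWithin_iff.2 ⟨(hcont w₀ hw₀).tendsto.mono_left nhdsWithin_le_nhds, ?_⟩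
    filter_upwards [self_mem_nhdsWithin, nhdsWithin_le_nhds (hV w₀ hw₀)] with w hne hw h
    exact hne (hinv.2.injOn hw hw₀ h)
  filter_upwards [hψ.eventually hderiv, nhdsWithin_le_nhds (hV w₀ hw₀)] with w hw hwV
  refine (HasDerivAt.of_local_left_inverse (hcont w hwV)
    (hd.differentiableAt (hU.mem_nhds (hmaps hwV))).hasDerivAt hw ?_).differentiableAt
  filter_upwards [hV w hwV] with y hy using hinv.2 hy

/-- Write `h s = h (1/2) - ∫ h'` over `[s, 1/2]`. The base point is interior because nothing is
assumed about `h` at `1`. -/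
theorem exists_tendsto_of_integrableOn_deriv {h h' : ℝ → ℂ}
    (hd : ∀ s ∈ Set.Ioo (0 : ℝ) 1, HasDerivAt h (h' s) s) (hi : IntegrableOn h' (Set.Ioo 0 1)) :
    ∃ l, Tendsto h (𝓝[>] 0) (𝓝 l) := by
  have hi' : IntegrableOn h' (Set.uIcc 0 (1 / 2)) := by
    rw [Set.uIcc_of_le (by norm_num), integrableOn_Icc_iff_integrableOn_Ioc]
    exact hi.mono_set fun x hx => ⟨hx.1, hx.2.trans_lt (by norm_num)⟩
  have hcont := intervalIntegral.continuousOn_primitive_interval_left (μ := volume) hi'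
  have h1 : Tendsto (fun s => ∫ t in s..(1 / 2), h' t) (𝓝[>] 0) (𝓝 (∫ t in (0)..(1 / 2), h' t)) := by
    refine (hcont 0 Set.left_mem_uIcc).mono_left ?_
    rw [Set.uIcc_of_le (by norm_num), ← nhdsWithin_Ioc_eq_nhdsGT (by norm_num : (0 : ℝ) < 1 / 2)]
    exact nhdsWithin_mono _ Set.Ioc_subset_Icc_self
  refine ⟨h (1 / 2) - ∫ t in (0)..(1 / 2), h' t, (tendsto_const_nhds.sub h1).congr' ?_⟩
  filter_upwards [Ioo_mem_nhdsGT (by norm_num : (0 : ℝ) < 1 / 2)] with s hs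
  have hsub : Set.uIcc s (1 / 2) ⊆ Set.Ioo 0 1 := by
    rw [Set.uIcc_of_le hs.2.le]
    exact fun x hx => ⟨hs.1.trans_le hx.1, hx.2.trans_lt (by norm_num)⟩
  rw [intervalIntegral.integral_eq_sub_of_hasDerivAt (fun x hx => hd x (hsub hx))
    ((hi.mono_set hsub).intervalIntegrable)]
  ring

theorem det_restrictScalars_toSpanSingleton (c : ℂ) :
    (((ContinuousLinearMap.toSpanSingleton ℂ c).restrictScalars ℝ : ℂ →L[ℝ] ℂ)).det = ‖c‖ ^ 2 := by
  simp [ContinuousLinearMap.det, LinearMap.det_restrictScalars, Algebra.norm_complex_apply,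
    Complex.normSq_eq_norm_sq]

/-- A univalent function of bounded image has boundary limits along almost every horizontal
segment of a rectangle. -/
theorem ae_exists_tendsto_of_injOn_rectangle {g : ℂ → ℂ} {a b : ℝ}
    (hd : DifferentiableOn ℂ g (Set.Ioo 0 1 ×ℂ Set.Ioo a b))
    (hinj : Set.InjOn g (Set.Ioo 0 1 ×ℂ Set.Ioo a b))
    (hbdd : Bornology.IsBounded (g '' (Set.Ioo 0 1 ×ℂ Set.Ioo a b))) :
    ∀ᵐ θ : ℝ, θ ∈ Set.Ioo a b →
      ∃ l, Tendsto (fun s : ℝ => g (s + θ * Complex.I)) (𝓝[>] 0) (𝓝 l) := by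
  set S := Set.Ioo (0 : ℝ) 1 ×ℂ Set.Ioo a b with hS
  have hSo : IsOpen S := isOpen_Ioo.reProdIm isOpen_Ioo
  -- The Jacobian of `g` is `|g'|²`, so by injectivity this integral is the area of the bounded
  -- image.
  have harea : ∫⁻ z in S, ENNReal.ofReal (‖deriv g z‖ ^ 2) < ⊤ := by
    have h := lintegral_abs_det_fderiv_eq_addHaar_image volume hSo.measurableSet
      (f' := fun z => (ContinuousLinearMap.toSpanSingleton ℂ (deriv g z)).restrictScalars ℝ)
      (fun z hz => ((hd.differentiableAt (hSo.mem_nhds hz)).hasDerivAt.hasFDerivAt.restrictScalars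
        ℝ).hasFDerivWithinAt) hinj
    simp only [det_restrictScalars_toSpanSingleton, abs_pow, abs_norm] at h
    rw [h]
    exact hbdd.measure_lt_top
  have hpre : Complex.measurableEquivRealProd.symm ⁻¹' S = Set.Ioo (0 : ℝ) 1 ×ˢ Set.Ioo a b := by
    ext p
    simp [hS, Complex.mem_reProdIm, Complex.measurableEquivRealProd_symm_apply]
  have hmeas : Measurable fun z => ENNReal.ofReal (‖deriv g z‖ ^ 2) :=
    ((measurable_deriv g).norm.pow_const 2).ennreal_ofReal
  have hmeas' : Measurable fun p : ℝ × ℝ =>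
      ENNReal.ofReal (‖deriv g (Complex.measurableEquivRealProd.symm p)‖ ^ 2) :=
    hmeas.comp Complex.measurableEquivRealProd.symm.measurable
  rw [← Complex.volume_preserving_equiv_real_prod.symm.setLIntegral_comp_preimage_emb
    Complex.measurableEquivRealProd.symm.measurableEmbedding, hpre,
    Measure.volume_eq_prod, ← Measure.prod_restrict,
    lintegral_prod_symm' _ hmeas'] at harea
  have hae := ae_lt_top hmeas'.lintegral_prod_left' harea.ne
  rw [ae_restrict_iff' measurableSet_Ioo] at hae
  filter_upwards [hae] with θ hθ hmem
  have hfin := hθ hmem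
  refine exists_tendsto_of_integrableOn_deriv (h' := fun s => deriv g (s + θ * Complex.I)) ?_ ?_
  · intro s hs
    have hz : (s + θ * Complex.I : ℂ) ∈ S := by
      simp [hS, Complex.mem_reProdIm, hs.1, hs.2, hmem.1, hmem.2]
    have h1 : HasDerivAt (fun t : ℂ => g (t + θ * Complex.I))
        (deriv g (s + θ * Complex.I)) (s : ℂ) :=
      HasDerivAt.comp_add_const (s : ℂ) (θ * Complex.I)
        (hd.differentiableAt (hSo.mem_nhds hz)).hasDerivAt
    exact h1.comp_ofReal
  · have hm : Measurable fun s : ℝ => deriv g (s + θ * Complex.I) :=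
      (measurable_deriv g).comp (by fun_prop)
    have hsq : IntegrableOn (fun s : ℝ => ‖deriv g (s + θ * Complex.I)‖ ^ 2) (Set.Ioo 0 1) := by
      refine ⟨(hm.norm.pow_const 2).aestronglyMeasurable, ?_⟩
      rw [hasFiniteIntegral_iff_ofReal (ae_of_all _ fun _ => by positivity)]
      refine lt_of_eq_of_lt (lintegral_congr fun s => ?_) hfin
      simp only [Complex.measurableEquivRealProd_symm_apply]
      rw [← Complex.mk_eq_add_mul_I]
    -- On an interval of finite length square integrability gives integrability, through `|x| ≤ 1 +
    -- |x|²`.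
    refine Integrable.mono' ((integrableOn_const (by simp) (C := (1 : ℝ))).add hsq)
      hm.aestronglyMeasurable (ae_of_all _ fun s => ?_)
    simp only [Pi.add_apply]
    nlinarith [sq_nonneg (‖deriv g (s + θ * Complex.I)‖ - 1),
      norm_nonneg (deriv g (s + θ * Complex.I))]

/-- The exponential carries horizontal segments to radii. It is injective on rectangles of height `2
< 2π`, and for `0 < Re z < 1` its modulus lies between `1` and `e < 3`. -/
theorem ae_exists_radial_limit {ψ : ℂ → ℂ} (hd : DifferentiableOn ℂ ψ {w : ℂ | 1 < ‖w‖})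
    (hinj : Set.InjOn ψ {w : ℂ | 1 < ‖w‖}) {M : ℝ}
    (hM : ∀ w : ℂ, 1 < ‖w‖ → ‖w‖ < 3 → ‖ψ w‖ ≤ M) :
    ∀ᵐ θ : ℝ, ∃ l,
      Tendsto (fun r : ℝ => ψ (r * Complex.exp (θ * Complex.I))) (𝓝[>] 1) (𝓝 l) := by
  have hstrip : ∀ k : ℤ, ∀ᵐ θ : ℝ, θ ∈ Set.Ioo (k : ℝ) (k + 2) → ∃ l,
      Tendsto (fun s : ℝ => ψ (Complex.exp (s + θ * Complex.I))) (𝓝[>] 0) (𝓝 l) := by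
    intro k
    have hmaps : ∀ z ∈ Set.Ioo (0 : ℝ) 1 ×ℂ Set.Ioo (k : ℝ) (k + 2),
        1 < ‖Complex.exp z‖ ∧ ‖Complex.exp z‖ < 3 := by
      intro z hz
      rw [Complex.mem_reProdIm] at hz
      rw [Complex.norm_exp]
      refine ⟨Real.one_lt_exp_iff.2 hz.1.1, (Real.exp_lt_exp.2 hz.1.2).trans ?_⟩
      linarith [Real.exp_one_lt_d9]
    refine ae_exists_tendsto_of_injOn_rectangle (g := fun z => ψ (Complex.exp z)) ?_ ?_ ?_
    · exact hd.comp Complex.differentiable_exp.differentiableOn fun z hz => (hmaps z hz).1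
    · intro z hz y hy h
      have h1 := hinj (hmaps z hz).1 (hmaps y hy).1 h
      obtain ⟨n, hn⟩ := Complex.exp_eq_exp_iff_exists_int.1 h1
      rw [Complex.mem_reProdIm] at hz hy
      have him := congrArg Complex.im hn
      simp at him
      have hn0 : n = 0 := by
        have hpi := Real.pi_gt_three
        by_contra hne
        rcases lt_or_gt_of_ne hne with hlt | hgt
        · have : (n : ℝ) ≤ -1 := by exact_mod_cast (by omega : n ≤ -1)
          nlinarith [hz.2.1, hz.2.2, hy.2.1, hy.2.2]
        · have : (1 : ℝ) ≤ n := by exact_mod_cast hgt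
          nlinarith [hz.2.1, hz.2.2, hy.2.1, hy.2.2]
      simpa [hn0] using hn
    · refine (Metric.isBounded_closedBall (x := (0 : ℂ)) (r := M)).subset ?_
      rintro _ ⟨z, hz, rfl⟩
      simpa using hM _ (hmaps z hz).1 (hmaps z hz).2
  have hlog : Tendsto Real.log (𝓝[>] 1) (𝓝[>] 0) := by
    refine tendsto_nhdsWithin_iff.2 ⟨?_, ?_⟩
    · simpa using (Real.continuousAt_log one_ne_zero).tendsto.mono_left
        (nhdsWithin_le_nhds (s := Set.Ioi (1 : ℝ)))
    · filter_upwards [self_mem_nhdsWithin] with r hr using Real.log_pos hr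
  filter_upwards [ae_all_iff.2 hstrip] with θ hθ
  -- The open intervals `(k, k + 2)` overlap, so integer values of `θ` are covered too.
  obtain ⟨l, hl⟩ := hθ (⌈θ⌉ - 1) ⟨by push_cast; linarith [Int.ceil_lt_add_one θ],
    by push_cast; linarith [Int.le_ceil θ]⟩
  refine ⟨l, (hl.comp hlog).congr' ?_⟩
  filter_upwards [self_mem_nhdsWithin] with r hr
  have hr0 : (0 : ℝ) < r := zero_lt_one.trans hr
  simp only [Function.comp]
  rw [Complex.exp_add, ← Complex.ofReal_exp, Real.exp_log hr0]

/-- Integrals over concentric circles in `|w| > 1` agree. -/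
theorem integral_circle_eq_of_differentiableOn_exterior {F : ℂ → ℂ}
    (hF : DifferentiableOn ℂ F {w : ℂ | 1 < ‖w‖}) {r ρ : ℝ} (hr : 1 < r) (hρ : r ≤ ρ) :
    ∫ θ in (0 : ℝ)..(2 * Real.pi), F (ρ * Complex.exp (θ * Complex.I)) =
      ∫ θ in (0 : ℝ)..(2 * Real.pi), F (r * Complex.exp (θ * Complex.I)) := by
  have hopen : IsOpen {w : ℂ | 1 < ‖w‖} := isOpen_lt continuous_const continuous_norm
  have h := Complex.circleIntegral_sub_center_inv_smul_eq_of_differentiable_on_annulus_off_countable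
    (c := 0) (f := F) (by linarith) hρ Set.countable_empty
    (hF.continuousOn.mono fun z hz => by
      have := hz.2
      simp only [Metric.mem_ball, dist_zero_right, not_lt] at this
      exact hr.trans_le this)
    (fun z hz => hF.differentiableAt (hopen.mem_nhds (by
      have := hz.1.2
      simp only [Metric.mem_closedBall, dist_zero_right, not_le] at this
      exact hr.trans this)))
  have key : ∀ s : ℝ, 1 < s → (∮ z in C(0, s), (z - 0)⁻¹ • F z) =
      Complex.I * ∫ θ in (0 : ℝ)..(2 * Real.pi), F (s * Complex.exp (θ * Complex.I)) := by
    intro s hs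
    rw [circleIntegral, ← intervalIntegral.integral_const_mul]
    refine intervalIntegral.integral_congr fun θ _ => ?_
    have hs0 : (s : ℂ) ≠ 0 := by exact_mod_cast (zero_lt_one.trans hs).ne'
    have := Complex.exp_ne_zero (θ * Complex.I)
    simp only [deriv_circleMap, circleMap, zero_add, sub_zero, smul_eq_mul]
    field_simp
  rw [key ρ (hr.trans_le hρ), key r hr] at h
  exact mul_left_cancel₀ Complex.I_ne_zero h

/-- Circle means do not depend on the radius `r > 1`; bounded convergence as `r ↓ 1` identifies them
with the boundary mean. -/
theorem integral_boundary_eq_integral_circle {F : ℂ → ℂ}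
    (hF : DifferentiableOn ℂ F {w : ℂ | 1 < ‖w‖}) {M : ℝ}
    (hM : ∀ w : ℂ, 1 < ‖w‖ → ‖w‖ < 3 → ‖F w‖ ≤ M) {b : ℝ → ℂ}
    (hb : ∀ᵐ θ : ℝ, Tendsto (fun r : ℝ => F (r * Complex.exp (θ * Complex.I))) (𝓝[>] 1)
      (𝓝 (b θ))) :
    IntervalIntegrable b volume 0 (2 * Real.pi) ∧
      ∫ θ in (0 : ℝ)..(2 * Real.pi), b θ =
        ∫ θ in (0 : ℝ)..(2 * Real.pi), F (2 * Complex.exp (θ * Complex.I)) := by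
  have hnorm : ∀ r θ : ℝ, 0 < r → ‖(r : ℂ) * Complex.exp (θ * Complex.I)‖ = r := by
    intro r θ hr
    rw [norm_mul, Complex.norm_exp_ofReal_mul_I, mul_one, Complex.norm_real,
      Real.norm_of_nonneg hr.le]
  have hnear : ∀ᶠ r : ℝ in 𝓝[>] 1, r ∈ Set.Ioo (1 : ℝ) 2 := Ioo_mem_nhdsGT one_lt_two
  have hcont : ∀ r : ℝ, 1 < r → Continuous fun θ : ℝ => F (r * Complex.exp (θ * Complex.I)) := by
    intro r hr
    refine hF.continuousOn.comp_continuous (by fun_prop) fun θ => ?_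
    change 1 < ‖_‖
    rwa [hnorm r θ (by linarith)]
  have hbound : ∀ r ∈ Set.Ioo (1 : ℝ) 2, ∀ θ : ℝ, ‖F (r * Complex.exp (θ * Complex.I))‖ ≤ M := by
    intro r hr θ
    have hr0 : 0 < r := by linarith [hr.1]
    exact hM _ (by rw [hnorm r θ hr0]; exact hr.1) (by rw [hnorm r θ hr0]; linarith [hr.2])
  -- Almost everywhere, `b` is the limit of continuous functions along a sequence of radii.
  have hbmeas : AEStronglyMeasurable b volume := by
    obtain ⟨u, hu⟩ := (𝓝[>] (1 : ℝ)).exists_seq_tendsto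
    obtain ⟨N, hN⟩ := eventually_atTop.1 (hu.eventually hnear)
    have hu' := hu.comp (tendsto_add_atTop_nat N)
    refine aestronglyMeasurable_of_tendsto_ae (u := atTop)
      (f := fun (n : ℕ) (θ : ℝ) => F (u (n + N) * Complex.exp (θ * Complex.I)))
      (fun n => (hcont _ (hN (n + N) (Nat.le_add_left _ _)).1).aestronglyMeasurable) ?_
    filter_upwards [hb] with θ hθ using hθ.comp hu'
  have hbb : ∀ᵐ θ : ℝ, ‖b θ‖ ≤ M := by
    filter_upwards [hb] with θ hθ
    exact le_of_tendsto hθ.norm (hnear.mono fun r hr => hbound r hr θ)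
  refine ⟨(intervalIntegrable_const (c := M)).mono_fun' hbmeas.restrict
    (ae_restrict_of_ae hbb), ?_⟩
  have hlim := intervalIntegral.tendsto_integral_filter_of_dominated_convergence
    (μ := volume) (a := 0) (b := 2 * Real.pi) (l := 𝓝[>] (1 : ℝ)) (f := b)
    (F := fun (r θ : ℝ) => F (r * Complex.exp (θ * Complex.I))) (fun _ => M)
    (hnear.mono fun r hr => (hcont r hr.1).aestronglyMeasurable)
    (hnear.mono fun r hr => ae_of_all _ fun θ _ => hbound r hr θ)
    intervalIntegrable_const (hb.mono fun θ hθ _ => hθ)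
  refine tendsto_nhds_unique hlim (tendsto_const_nhds.congr' ?_)
  filter_upwards [hnear] with r hr
  exact_mod_cast integral_circle_eq_of_differentiableOn_exterior hF hr.1 hr.2.le

end ExteriorFunctions

end

noncomputable section

/-! ### Laurent series in `|w| > 1` and their coefficients -/

section LaurentSeries

theorem isPreconnected_one_lt_norm : IsPreconnected {w : ℂ | 1 < ‖w‖} := by
  have h : Complex.exp '' {z : ℂ | 0 < z.re} = {w : ℂ | 1 < ‖w‖} := by
    ext w
    constructor
    · rintro ⟨z, hz, rfl⟩
      change 1 < ‖_‖
      rw [Complex.norm_exp]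
      exact Real.one_lt_exp_iff.2 hz
    · intro hw
      have hw' : 1 < ‖w‖ := hw
      have hw0 : w ≠ 0 := norm_pos_iff.1 (zero_lt_one.trans hw')
      refine ⟨Complex.log w, ?_, Complex.exp_log hw0⟩
      change 0 < (Complex.log w).re
      rw [Complex.log_re]
      exact Real.log_pos hw'
  rw [← h]
  exact (convex_halfSpace_re_gt 0).isPreconnected.image _ Complex.continuous_exp.continuousOn

theorem differentiableOn_tsum_mul_inv_pow {c : ℕ → ℂ} {B : ℝ} (hc : ∀ m, ‖c m‖ ≤ B) :
    DifferentiableOn ℂ (fun w => ∑' m, c m * w⁻¹ ^ m) {w : ℂ | 1 < ‖w‖} := by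
  intro w hw
  obtain ⟨r, hr1, hr⟩ := exists_between (show 1 < ‖w‖ from hw)
  have hr0 : 0 < r := zero_lt_one.trans hr1
  have hopen : IsOpen {w : ℂ | r < ‖w‖} := isOpen_lt continuous_const continuous_norm
  have hne : ∀ z ∈ {w : ℂ | r < ‖w‖}, z ≠ 0 := fun z hz =>
    norm_pos_iff.1 (hr0.trans hz)
  refine ((Complex.differentiableOn_tsum_of_summable_norm (u := fun m => B * r⁻¹ ^ m)
    ((summable_geometric_of_lt_one (by positivity) (inv_lt_one_of_one_lt₀ hr1)).mul_left B)
    (fun m z hz => ?_) hopen (fun m z hz => ?_)).differentiableAt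
      (hopen.mem_nhds hr)).differentiableWithinAt
  · exact (((differentiableAt_inv (hne z hz)).pow m).const_mul (c m)).differentiableWithinAt
  · rw [norm_mul, norm_pow, norm_inv]
    have hz' : r < ‖z‖ := hz
    have hB : 0 ≤ B := (norm_nonneg _).trans (hc m)
    gcongr
    exact hc m

theorem integral_exp_int_mul (k : ℤ) :
    ∫ θ in (0 : ℝ)..(2 * Real.pi), Complex.exp (k * (θ * Complex.I)) =
      if k = 0 then (2 * Real.pi : ℂ) else 0 := by
  split_ifs with h
  · simp [h]
  · have hk : (k * Complex.I : ℂ) ≠ 0 :=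
      mul_ne_zero (by exact_mod_cast h) Complex.I_ne_zero
    have h1 := integral_exp_mul_complex (a := 0) (b := 2 * Real.pi) hk
    have h2 : Complex.exp (k * Complex.I * ((2 * Real.pi : ℝ) : ℂ)) = 1 := by
      rw [Complex.exp_eq_one_iff]
      exact ⟨k, by push_cast; ring⟩
    rw [h2, Complex.ofReal_zero, mul_zero, Complex.exp_zero, sub_self, zero_div] at h1
    rw [← h1]
    congr 1
    ext θ
    congr 1
    ring

/-- The `j`-th coefficient of a Laurent series as a circle mean. -/
theorem integral_circle_pow_mul_tsum {c : ℕ → ℂ} {B : ℝ} (hc : ∀ m, ‖c m‖ ≤ B) {ρ : ℝ}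
    (hρ : 1 < ρ) (j : ℕ) :
    ∫ θ in (0 : ℝ)..(2 * Real.pi), (ρ * Complex.exp (θ * Complex.I)) ^ j *
      ∑' m, c m * (ρ * Complex.exp (θ * Complex.I))⁻¹ ^ m = 2 * Real.pi * c j := by
  have hρ0 : 0 < ρ := zero_lt_one.trans hρ
  have hρC : (ρ : ℂ) ≠ 0 := by exact_mod_cast hρ0.ne'
  have hnorm : ∀ θ : ℝ, ‖(ρ : ℂ) * Complex.exp (θ * Complex.I)‖ = ρ := by
    intro θ
    rw [norm_mul, Complex.norm_exp_ofReal_mul_I, mul_one, Complex.norm_real,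
      Real.norm_of_nonneg hρ0.le]
  have hgeom : Summable fun m : ℕ => B * ρ⁻¹ ^ m :=
    (summable_geometric_of_lt_one (by positivity) (inv_lt_one_of_one_lt₀ hρ)).mul_left B
  have hle : ∀ (m : ℕ) (θ : ℝ),
      ‖c m * (ρ * Complex.exp (θ * Complex.I))⁻¹ ^ m‖ ≤ B * ρ⁻¹ ^ m := by
    intro m θ
    rw [norm_mul, norm_pow, norm_inv, hnorm]
    gcongr
    exact hc m
  have hsum := intervalIntegral.hasSum_integral_of_dominated_convergence
    (μ := volume) (a := 0) (b := 2 * Real.pi)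
    (F := fun (m : ℕ) (θ : ℝ) => (ρ * Complex.exp (θ * Complex.I)) ^ j *
      (c m * (ρ * Complex.exp (θ * Complex.I))⁻¹ ^ m))
    (f := fun θ : ℝ => (ρ * Complex.exp (θ * Complex.I)) ^ j *
      ∑' m, c m * (ρ * Complex.exp (θ * Complex.I))⁻¹ ^ m)
    (fun m _ => ρ ^ j * (B * ρ⁻¹ ^ m))
    (fun m => by
      have hne : ∀ θ : ℝ, (ρ : ℂ) * Complex.exp (θ * Complex.I) ≠ 0 := fun θ =>
        mul_ne_zero hρC (Complex.exp_ne_zero _)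
      have hcont : Continuous fun θ : ℝ => (ρ : ℂ) * Complex.exp (θ * Complex.I) := by fun_prop
      exact ((hcont.pow j).mul (continuous_const.mul ((hcont.inv₀ hne).pow m))).aestronglyMeasurable)
    (fun m => ae_of_all _ fun θ _ => by
      rw [norm_mul, norm_pow, hnorm]
      exact mul_le_mul_of_nonneg_left (hle m θ) (by positivity))
    (ae_of_all _ fun θ _ => hgeom.mul_left _)
    intervalIntegrable_const
    (ae_of_all _ fun θ _ =>
      (Summable.of_norm_bounded hgeom fun m => hle m θ).hasSum.mul_left _)
  have hterm : ∀ m : ℕ, ∫ θ in (0 : ℝ)..(2 * Real.pi), (ρ * Complex.exp (θ * Complex.I)) ^ j *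
      (c m * (ρ * Complex.exp (θ * Complex.I))⁻¹ ^ m) =
        if m = j then 2 * Real.pi * c j else 0 := by
    intro m
    have hrw : ∀ θ : ℝ, (ρ * Complex.exp (θ * Complex.I)) ^ j *
        (c m * (ρ * Complex.exp (θ * Complex.I))⁻¹ ^ m) =
        ((ρ : ℂ) ^ j * c m * (ρ : ℂ)⁻¹ ^ m) *
          Complex.exp (((j - m : ℤ) : ℂ) * (θ * Complex.I)) := by
      intro θ
      rw [Complex.exp_int_mul, zpow_sub₀ (Complex.exp_ne_zero _), zpow_natCast, zpow_natCast,
        mul_pow, mul_inv, mul_pow, inv_pow (Complex.exp _)]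
      ring
    simp only [hrw]
    rw [intervalIntegral.integral_const_mul, integral_exp_int_mul]
    rcases eq_or_ne m j with rfl | h
    · rw [if_pos (sub_self _), if_pos rfl, inv_pow]
      field_simp
    · rw [if_neg (fun h' => h (by omega)), if_neg h, mul_zero]
  simp only [hterm] at hsum
  exact hsum.unique (hasSum_ite_eq j _)

end LaurentSeries

/-! ### Limits of the expansion coefficients from ratio asymptotics -/

section RatioAsymptotics

variable {μ : Measure ℂ}

theorem norm_polyInner_X_pow_mul_le [IsFiniteMeasure μ] (hc : IsCompact μ.support)
    (hi : μ.support.Infinite) {R : ℝ} (hR0 : 0 ≤ R) (hR : ∀ z ∈ μ.support, ‖z‖ ≤ R)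
    (j n k : ℕ) :
    ‖polyInner μ (X ^ j * orthonormalPoly μ n) (orthonormalPoly μ k)‖ ≤ R ^ j := by
  have h := norm_integral_mul_pairing_le hc (pow_nonneg hR0 j) (m := X ^ j)
    (fun z hz => by
      rw [eval_pow, eval_X, norm_pow]
      exact pow_le_pow_left₀ (norm_nonneg z) (hR z hz) j)
    (orthonormalPoly μ n) (orthonormalPoly μ k) one_pos
  rw [polyNormSq_orthonormalPoly hc hi, polyNormSq_orthonormalPoly hc hi] at h
  exact h.trans_eq (by ring)

/-- Telescoping the one-step ratio bound. For `|z| > 2 R` the base is below `1`, so this is the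
geometric majorant for the limit of the expansion. -/
theorem norm_orthonormalPoly_div_le [IsFiniteMeasure μ] (hc : IsCompact μ.support)
    (hi : μ.support.Infinite) {R : ℝ} (hR0 : 0 ≤ R) (hR : ∀ z ∈ μ.support, ‖z‖ ≤ R) {z : ℂ}
    (hz : R < ‖z‖) (n m : ℕ) :
    ‖(orthonormalPoly μ n).eval z / (orthonormalPoly μ (n + m)).eval z‖ ≤
      (R / (‖z‖ - R)) ^ m := by
  have hne := eval_orthonormalPoly_ne_zero hc hi hR hz
  have hd : 0 < ‖z‖ - R := sub_pos.2 hz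
  induction m with
  | zero => rw [add_zero, div_self (hne n), norm_one, pow_zero]
  | succ m ih =>
    rw [← div_mul_div_cancel₀ (hne (n + m)), norm_mul, pow_succ]
    exact mul_le_mul ih (norm_orthonormalPoly_ratio_le hc hi hR0 hR hz (n + m)) (norm_nonneg _)
      (by positivity)

theorem tendsto_orthonormalPoly_div [IsFiniteMeasure μ] (hc : IsCompact μ.support)
    (hi : μ.support.Infinite) {R : ℝ} (hR : ∀ z ∈ μ.support, ‖z‖ ≤ R) {z : ℂ}
    (hz : R < ‖z‖) {t : ℂ}
    (ht : Tendsto (fun n : ℕ => (orthonormalPoly μ n).eval z / (orthonormalPoly μ (n + 1)).eval z)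
      atTop (𝓝 t)) (m : ℕ) :
    Tendsto (fun n : ℕ => (orthonormalPoly μ n).eval z / (orthonormalPoly μ (n + m)).eval z)
      atTop (𝓝 (t ^ m)) := by
  have hne := eval_orthonormalPoly_ne_zero hc hi hR hz
  induction m with
  | zero => simp [div_self (hne _)]
  | succ m ih =>
    rw [pow_succ]
    refine (ih.mul (ht.comp (tendsto_add_atTop_nat m))).congr fun n => ?_
    exact div_mul_div_cancel₀ (hne (n + m))

/-- The coefficient of `φ_{n+j-m}` in the expansion of `z ^ j φ_n`. -/
def shiftCoeff (μ : Measure ℂ) (j n m : ℕ) : ℂ :=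
  if m ≤ n + j then
    polyInner μ (X ^ j * orthonormalPoly μ n) (orthonormalPoly μ (n + j - m))
  else 0

theorem norm_shiftCoeff_le [IsFiniteMeasure μ] (hc : IsCompact μ.support)
    (hi : μ.support.Infinite) {R : ℝ} (hR0 : 0 ≤ R) (hR : ∀ z ∈ μ.support, ‖z‖ ≤ R)
    (j n m : ℕ) : ‖shiftCoeff μ j n m‖ ≤ R ^ j := by
  unfold shiftCoeff
  split_ifs
  · exact norm_polyInner_X_pow_mul_le hc hi hR0 hR j n _
  · rw [norm_zero]
    exact pow_nonneg hR0 j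

/-- Counting `m` down from the top degree and extending by zero makes the index set independent of
`n`, as dominated convergence for series requires. -/
theorem pow_mul_eval_div_eq_tsum [IsFiniteMeasure μ] (hc : IsCompact μ.support)
    (hi : μ.support.Infinite) (j n : ℕ) (z : ℂ) :
    z ^ j * ((orthonormalPoly μ n).eval z / (orthonormalPoly μ (n + j)).eval z) =
      ∑' m, shiftCoeff μ j n m *
        ((orthonormalPoly μ (n + j - m)).eval z / (orthonormalPoly μ (n + j)).eval z) := by
  have hdeg : (X ^ j * orthonormalPoly μ n).degree < ((n + j + 1 : ℕ) : WithBot ℕ) := by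
    rw [degree_mul, degree_X_pow, orthonormalPoly_degree hc hi]
    exact_mod_cast (by omega : j + n < n + j + 1)
  have h := congrArg (eval z) (eq_sum_polyInner_orthonormalPoly hc hi _ _ hdeg)
  rw [eval_mul, eval_pow, eval_X, eval_finsetSum, ← Finset.sum_range_reflect] at h
  rw [← mul_div_assoc, h, tsum_eq_sum (s := Finset.range (n + j + 1)), Finset.sum_div]
  · refine Finset.sum_congr rfl fun m hm => ?_
    have hm' : m ≤ n + j := Nat.lt_succ_iff.1 (Finset.mem_range.1 hm)
    rw [shiftCoeff, if_pos hm', eval_mul, eval_C, mul_div_assoc,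
      show n + j + 1 - 1 - m = n + j - m by omega]
  · intro m hm
    rw [shiftCoeff, if_neg (by simpa [Nat.lt_succ_iff] using hm), zero_mul]

/-- Passing to the limit along an ultrafilter in the expansion of `z ^ j φ_n / φ_{n+j}`. -/
theorem pow_mul_pow_eq_tsum_of_tendsto [IsFiniteMeasure μ] (hc : IsCompact μ.support)
    (hi : μ.support.Infinite) {R : ℝ} (hR0 : 0 ≤ R) (hR : ∀ z ∈ μ.support, ‖z‖ ≤ R) {z t : ℂ}
    (hz : 2 * R < ‖z‖)
    (ht : Tendsto (fun n : ℕ => (orthonormalPoly μ n).eval z / (orthonormalPoly μ (n + 1)).eval z)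
      atTop (𝓝 t)) {l : Filter ℕ} [l.NeBot] (hl : l ≤ atTop) (j : ℕ) {c : ℕ → ℂ}
    (hlim : ∀ m, Tendsto (fun n => shiftCoeff μ j n m) l (𝓝 (c m))) :
    z ^ j * t ^ j = ∑' m, c m * t ^ m := by
  have hzR : R < ‖z‖ := by linarith
  have hd : 0 < ‖z‖ - R := sub_pos.2 hzR
  set q := R / (‖z‖ - R) with hq
  have hq0 : 0 ≤ q := by positivity
  have hq1 : q < 1 := (div_lt_one hd).2 (by linarith)
  have hleft := ((tendsto_orthonormalPoly_div hc hi hR hzR ht j).mono_left hl).const_mul (z ^ j)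
  refine tendsto_nhds_unique hleft ?_
  simp only [pow_mul_eval_div_eq_tsum hc hi]
  refine tendsto_tsum_of_dominated_convergence (bound := fun m => R ^ j * q ^ m)
    ((summable_geometric_of_lt_one hq0 hq1).mul_left _) (fun m => ?_)
    (Eventually.of_forall fun n m => ?_)
  · refine (hlim m).mul (Tendsto.mono_left ?_ hl)
    have hshift : Tendsto (fun n : ℕ => n + j - m) atTop atTop :=
      (tendsto_sub_atTop_nat m).comp (tendsto_add_atTop_nat j)
    -- The truncated subtraction `n + j - m` is harmless once `n ≥ m`.
    refine ((tendsto_orthonormalPoly_div hc hi hR hzR ht m).comp hshift).congr' ?_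
    filter_upwards [eventually_ge_atTop m] with n hn
    simp only [Function.comp]
    rw [Nat.sub_add_cancel (by omega)]
  · by_cases hm : m ≤ n + j
    · rw [norm_mul]
      refine mul_le_mul (norm_shiftCoeff_le hc hi hR0 hR j n m) ?_ (norm_nonneg _) (by positivity)
      have h := norm_orthonormalPoly_div_le hc hi hR0 hR hzR (n + j - m) m
      rwa [Nat.sub_add_cancel hm] at h
    · rw [shiftCoeff, if_neg hm, zero_mul, norm_zero]
      positivity

/-- The moment is the diagonal coefficient, and each of its ultrafilter limits is the same Laurent
coefficient of `ψ ^ j`. Radius `2` is an arbitrary choice inside `|w| > 1`. -/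
theorem tendsto_integral_pow_mul_normSq [IsFiniteMeasure μ] (hc : IsCompact μ.support)
    (hi : μ.support.Infinite) {K : Set ℂ} (hK : IsCompact K) {φ ψ : ℂ → ℂ}
    (hφ : IsExteriorConformalMap K φ) (hψ : Set.InvOn ψ φ Kᶜ {w : ℂ | 1 < ‖w‖})
    (hratio : ∃ R : ℝ, ∀ z : ℂ, R < ‖z‖ →
      Tendsto (fun n : ℕ => (orthonormalPoly μ n).eval z / (orthonormalPoly μ (n + 1)).eval z)
        atTop (𝓝 (1 / φ z))) (j : ℕ) :
    Tendsto (fun n : ℕ => ∫ z, z ^ j * ((‖(orthonormalPoly μ n).eval z‖ ^ 2 : ℝ) : ℂ) ∂μ) atTop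
      (𝓝 ((∫ θ in (0 : ℝ)..(2 * Real.pi), ψ (2 * Complex.exp (θ * Complex.I)) ^ j) /
        (2 * Real.pi))) := by
  obtain ⟨R₁, hR₁⟩ := hratio
  obtain ⟨R, hR0, hR⟩ : ∃ R : ℝ, 0 ≤ R ∧ ∀ z ∈ μ.support, ‖z‖ ≤ R := by
    obtain ⟨R, hR⟩ := hc.isBounded.exists_norm_le
    exact ⟨max R 0, le_max_right _ _, fun z hz => (hR z hz).trans (le_max_left _ _)⟩
  have hdiag : ∀ n : ℕ, ∫ z, z ^ j * ((‖(orthonormalPoly μ n).eval z‖ ^ 2 : ℝ) : ℂ) ∂μ =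
      shiftCoeff μ j n j := by
    intro n
    rw [shiftCoeff, if_pos (Nat.le_add_left j n), Nat.add_sub_cancel, polyInner]
    congr 1
    ext z
    rw [eval_mul, eval_pow, eval_X, mul_assoc, Complex.mul_conj, Complex.normSq_eq_norm_sq]
  simp only [hdiag]
  -- Along an ultrafilter all bounded coefficient sequences converge at once, with no diagonal
  -- extraction.
  rw [Filter.tendsto_iff_ultrafilter]
  intro l hl
  have hex : ∀ m, ∃ x ∈ Metric.closedBall (0 : ℂ) (R ^ j),
      Tendsto (fun n => shiftCoeff μ j n m) l (𝓝 x) := by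
    intro m
    refine (isCompact_closedBall (0 : ℂ) (R ^ j)).ultrafilter_le_nhds
      (l.map fun n => shiftCoeff μ j n m) ?_
    rw [le_principal_iff]
    exact mem_map.2 (univ_mem' fun n => by
      simpa using norm_shiftCoeff_le hc hi hR0 hR j n m)
  choose c hcB hclim using hex
  have hcB' : ∀ m, ‖c m‖ ≤ R ^ j := fun m => by simpa using hcB m
  suffices h : (∫ θ in (0 : ℝ)..(2 * Real.pi), ψ (2 * Complex.exp (θ * Complex.I)) ^ j) /
      (2 * Real.pi) = c j by
    rw [h]
    exact hclim j
  have hopen : IsOpen {w : ℂ | 1 < ‖w‖} := isOpen_lt continuous_const continuous_norm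
  have hψan : AnalyticOnNhd ℂ ψ {w : ℂ | 1 < ‖w‖} := fun w hw =>
    analyticAt_of_invOn hK.isClosed.isOpen_compl hφ.differentiableOn hφ.bijOn hψ hw
  have hwne : ∀ w ∈ {w : ℂ | 1 < ‖w‖}, w ≠ 0 := fun w hw =>
    norm_pos_iff.1 (zero_lt_one.trans hw)
  obtain ⟨z₀, hz₀K, hz₀⟩ : ∃ z₀ ∈ Kᶜ, max R₁ (2 * R) < ‖z₀‖ := by
    obtain ⟨RK, hRK⟩ := hK.isBounded.exists_norm_le
    obtain ⟨z₀, hz₀⟩ := NormedField.exists_lt_norm ℂ (max RK (max R₁ (2 * R)))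
    exact ⟨z₀, fun h => absurd (hRK z₀ h) (not_le.2 ((le_max_left _ _).trans_lt hz₀)),
      (le_max_right _ _).trans_lt hz₀⟩
  have hw₀ : φ z₀ ∈ {w : ℂ | 1 < ‖w‖} := hφ.bijOn.mapsTo hz₀K
  -- The limit relation is available only where `ψ w` is large, hence near `φ z₀`; the identity
  -- theorem extends it to all of `|w| > 1`.
  have heq : Set.EqOn (fun w => ψ w ^ j * w⁻¹ ^ j) (fun w => ∑' m, c m * w⁻¹ ^ m)
      {w : ℂ | 1 < ‖w‖} := by
    refine AnalyticOnNhd.eqOn_of_preconnected_of_eventuallyEq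
      (fun w hw => ((hψan w hw).pow j).mul ((analyticAt_inv (hwne w hw)).pow j))
      ((differentiableOn_tsum_mul_inv_pow hcB').analyticOnNhd hopen)
      isPreconnected_one_lt_norm hw₀ ?_
    have hnear : ∀ᶠ w in 𝓝 (φ z₀), max R₁ (2 * R) < ‖ψ w‖ := by
      refine (hψan _ hw₀).continuousAt.norm.eventually_const_lt ?_
      simpa only [hψ.1 hz₀K] using hz₀
    filter_upwards [hnear, hopen.mem_nhds hw₀] with w hw hw1
    have ht := hR₁ (ψ w) ((le_max_left _ _).trans_lt hw)
    rw [hψ.2 hw1, one_div] at ht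
    exact pow_mul_pow_eq_tsum_of_tendsto hc hi hR0 hR ((le_max_right _ _).trans_lt hw) ht hl j hclim
  have hint := integral_circle_pow_mul_tsum hcB' one_lt_two j
  have hcongr : ∀ θ : ℝ, ψ (2 * Complex.exp (θ * Complex.I)) ^ j =
      (((2 : ℝ) : ℂ) * Complex.exp (θ * Complex.I)) ^ j *
        ∑' m, c m * (((2 : ℝ) : ℂ) * Complex.exp (θ * Complex.I))⁻¹ ^ m := by
    intro θ
    have hw : (2 * Complex.exp (θ * Complex.I) : ℂ) ∈ {w : ℂ | 1 < ‖w‖} := by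
      change 1 < ‖_‖
      rw [norm_mul, Complex.norm_exp_ofReal_mul_I]
      norm_num
    have h := heq hw
    simp only at h
    rw [Complex.ofReal_ofNat, ← h, mul_left_comm, ← mul_pow, mul_inv_cancel₀ (hwne _ hw), one_pow,
      mul_one]
  simp only [hcongr]
  rw [hint]
  have hpi : (Real.pi : ℂ) ≠ 0 := by exact_mod_cast Real.pi_ne_zero
  field_simp

end RatioAsymptotics

end

/-! ### The limit theorem -/

theorem theorem1p8
    (μ : Measure ℂ) [IsFiniteMeasure μ]
    (hμ_compact : IsCompact μ.support) (hμ_inf : μ.support.Infinite)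
    (K : Set ℂ) (hK : IsCompact K) (hJ : IsJordanCurve (frontier K))
    (φ ψ : ℂ → ℂ) (hφ : IsExteriorConformalMap K φ)
    (hψ : Set.InvOn ψ φ Kᶜ {w : ℂ | 1 < ‖w‖})
    (hratio : ∃ R : ℝ, ∀ z : ℂ, R < ‖z‖ →
      Tendsto (fun n : ℕ => (orthonormalPoly μ n).eval z / (orthonormalPoly μ (n + 1)).eval z)
        atTop (𝓝 (1 / φ z))) :
    -- the boundary values `ψ (exp (i θ))` exist for almost every `θ`
    (∀ᵐ θ : ℝ, Tendsto (fun r : ℝ => ψ ((r : ℂ) * Complex.exp (θ * Complex.I))) (𝓝[>] (1 : ℝ))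
      (𝓝 (exteriorBoundaryValue ψ (Complex.exp (θ * Complex.I))))) ∧
    ∀ j : ℕ,
      IntervalIntegrable
        (fun θ : ℝ => exteriorBoundaryValue ψ (Complex.exp (θ * Complex.I)) ^ j)
        volume 0 (2 * Real.pi) ∧
      Tendsto
        (fun n : ℕ => ∫ z, z ^ j * ((‖(orthonormalPoly μ n).eval z‖ ^ 2 : ℝ) : ℂ) ∂μ)
        atTop
        (𝓝 (∫ θ in (0 : ℝ)..(2 * Real.pi),
          exteriorBoundaryValue ψ (Complex.exp (θ * Complex.I)) ^ j / (2 * Real.pi))) := by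
  have hψd : DifferentiableOn ℂ ψ {w : ℂ | 1 < ‖w‖} := fun w hw =>
    (analyticAt_of_invOn hK.isClosed.isOpen_compl hφ.differentiableOn hφ.bijOn hψ
      hw).differentiableAt.differentiableWithinAt
  obtain ⟨M, hM⟩ : ∃ M : ℝ, ∀ w : ℂ, 1 < ‖w‖ → ‖w‖ < 3 → ‖ψ w‖ ≤ M := by
    -- As `φ` tends to infinity at infinity, points with `‖φ z‖ < 3` form a bounded set, which
    -- contains `ψ w` for `1 < ‖w‖ < 3`.
    have h1 : {z : ℂ | 3 ≤ ‖φ z‖} ∈ Bornology.cobounded ℂ :=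
      (tendsto_norm_cobounded_atTop.comp hφ.map_infty).eventually_ge_atTop 3
    obtain ⟨M, hM⟩ := (Bornology.isBounded_def.2 (by rwa [compl_compl]) :
      Bornology.IsBounded {z : ℂ | 3 ≤ ‖φ z‖}ᶜ).exists_norm_le
    refine ⟨M, fun w hw hw3 => hM _ fun h => ?_⟩
    have h2 : 3 ≤ ‖φ (ψ w)‖ := h
    rw [hψ.2 hw] at h2
    linarith
  have hbv : ∀ᵐ θ : ℝ, Tendsto (fun r : ℝ => ψ ((r : ℂ) * Complex.exp (θ * Complex.I)))
      (𝓝[>] (1 : ℝ)) (𝓝 (exteriorBoundaryValue ψ (Complex.exp (θ * Complex.I)))) := by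
    filter_upwards [ae_exists_radial_limit hψd hψ.2.injOn hM] with θ hθ
    exact tendsto_nhds_limUnder hθ
  refine ⟨hbv, fun j => ?_⟩
  obtain ⟨hint, heq⟩ := integral_boundary_eq_integral_circle (F := fun w => ψ w ^ j)
    (b := fun θ => exteriorBoundaryValue ψ (Complex.exp (θ * Complex.I)) ^ j) (M := M ^ j)
    (hψd.pow j)
    (fun w hw hw3 => by
      rw [norm_pow]
      exact pow_le_pow_left₀ (norm_nonneg _) (hM w hw hw3) j)
    (hbv.mono fun θ hθ => hθ.pow j)
  refine ⟨hint, ?_⟩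
  rw [intervalIntegral.integral_div, heq]
  exact tendsto_integral_pow_mul_normSq hμ_compact hμ_inf hK hφ hψ hratio j
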